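/- Let $\Sigma$ be a fixed finite nonempty alphabet and let $d\ge 1$ be a real constant. For every $n$, consider a random nondeterministic finite automaton $\mathcal A$ (without $\varepsilon$-transitions) over $\Sigma$ with $n$ states such that, for each letter $a\in\Sigma$, the transition matrix $T^{(a)}$ (the $n\times n$ Boolean matrix with $T^{(a)}_{i,j}=1$ iff there is an $a$-transition from state $i$ to state $j$) is uniformly distributed on the set of $n\times n$ Boolean matrices with exactly $m$ nonzero entries, where $m=n^2/d$, rounded down or up if this is not an integer. The matrices of different letters need not be independent, and the sets of starting and accepting states are arbitrary (and may depend on the matrices). Let $\mathcal S(\mathcal A)$ be the transition monoid of $\mathcal A$, i.e. the monoid of Boolean matrices generated by the $T^{(a)}$, $a\in\Sigma$, under Boolean matrix multiplication, including the identity matrix. Below, $\log$ is the natural logarithm, "with high probability" means with probability at least $1-\delta_n$ for some $\delta_n\to 0$, and $\delta_n$, the $o(1)$ term (as $n\to\infty$) and the $O$-constant depend only on $d$ and $\Sigma$. 1. If $|\Sigma|\ge 2$, then with high probability $$|\mathcal S(\mathcal A)|\le 2\,|\Sigma|^{\,d\log n+o(1)}.$$ 2. With high probability, the on-the-fly determinization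 of $\mathcal A$ (the power set construction that starts in the set of starting states and explores only the sets of states reachable from it) terminates with a deterministic automaton that has at most $O\!\left(n^{d\log|\Sigma|}\right)$ states, which is polynomial in $n$. -/

import Mathlib

/-- Square Boolean matrices with rows and columns indexed by `Q`.  This is a `def` (not an
abbreviation of `Matrix Q Q Bool`) so that the product below, over the Boolean semifield
`({0, 1}, ∨, ∧)`, is the only one in sight: Mathlib's ring structure on `Bool` adds with xor. -/
def BoolMatrix (Q : Type*) : Type _ := Q → Q → Bool

namespace BoolMatrix

instance {Q : Type*} [Finite Q] : Finite (BoolMatrix Q) :=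
  inferInstanceAs (Finite (Q → Q → Bool))

noncomputable instance {Q : Type*} [Fintype Q] : Fintype (BoolMatrix Q) :=
  Fintype.ofFinite _

open Classical in
/-- Boolean matrices form a monoid under the Boolean matrix product, with the identity matrix
as neutral element. -/
noncomputable instance {Q : Type*} : Monoid (BoolMatrix Q) where
  mul B C := fun i j => decide (∃ k, B i k = true ∧ C k j = true)
  one := fun i j => decide (i = j)
  mul_assoc A B C := by
    funext i j
    apply decide_eq_decide.mpr
    constructor
    · rintro ⟨k, hk, hc⟩
      obtain ⟨l, ha, hb⟩ := of_decide_eq_true hk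
      exact ⟨l, ha, decide_eq_true ⟨k, hb, hc⟩⟩
    · rintro ⟨k, ha, hk⟩
      obtain ⟨l, hb, hc⟩ := of_decide_eq_true hk
      exact ⟨l, decide_eq_true ⟨k, ha, hb⟩, hc⟩
  one_mul A := by
    funext i j
    apply Bool.eq_iff_iff.mpr
    refine decide_eq_true_iff.trans ⟨?_, fun h => ⟨i, decide_eq_true rfl, h⟩⟩
    rintro ⟨k, hk, h⟩
    rw [of_decide_eq_true hk]
    exact h
  mul_one A := by
    funext i j
    apply Bool.eq_iff_iff.mpr
    refine decide_eq_true_iff.trans ⟨?_, fun h => ⟨j, h, decide_eq_true rfl⟩⟩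
    rintro ⟨k, h, hk⟩
    rw [← of_decide_eq_true hk]
    exact h

/-- The number of nonzero entries. -/
def nnz {Q : Type*} [Fintype Q] (B : BoolMatrix Q) : ℕ :=
  (Finset.univ.filter fun p : Q × Q => B p.1 p.2 = true).card

/-- The set of `n × n` Boolean matrices with exactly `m` nonzero entries. -/
noncomputable def withNnz (n m : ℕ) : Finset (BoolMatrix (Fin n)) :=
  Finset.univ.filter fun B => B.nnz = m

end BoolMatrix

namespace NFA

open Classical in
/-- The Boolean matrix of the letter `a`: its `(p, q)` entry is `1` iff there is an
`a`-transition from `p` to `q`. -/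
noncomputable def transitionMatrix {α σ : Type*} (M : NFA α σ) (a : α) : BoolMatrix σ :=
  fun p q => decide (q ∈ M.step p a)

/-- The monoid generated by the transition matrices (it contains the identity). -/
noncomputable def transitionMonoid {α σ : Type*} (M : NFA α σ) : Submonoid (BoolMatrix σ) :=
  Submonoid.closure (Set.range M.transitionMatrix)

/-- The variables of the on-the-fly determinization while it runs: the stack of power states still
to be processed, the power states found so far, and the transitions between them. -/
structure OnTheFlyConfig (α σ : Type*) where
  stack : List (Set σ)
  states : Finset (Set σ)
  trans : Finset (Set σ × α × Set σ)

/-- The deterministic automaton returned by the on-the-fly determinization. -/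
structure PowerAutomaton (α σ : Type*) where
  states : Finset (Set σ)
  start : Set σ
  accept : Finset (Set σ)
  trans : Finset (Set σ × α × Set σ)

/-- Initially the stack and the set of power states hold just the set of starting states. -/
def onTheFlyInit {α σ : Type*} (M : NFA α σ) : OnTheFlyConfig α σ where
  stack := [M.start]
  states := {M.start}
  trans := ∅

open Classical in
/-- The body of the inner loop: the popped power state is `S` and the current letter is `a`.
`M.stepSet S a` is the set of all states reached by an `a`-transition from a member of `S`. -/
noncomputable def onTheFlyLetter {α σ : Type*} (M : NFA α σ) (S : Set σ)
    (c : OnTheFlyConfig α σ) (a : α) : OnTheFlyConfig α σ where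
  stack := if M.stepSet S a ∈ c.states then c.stack else M.stepSet S a :: c.stack
  states := insert (M.stepSet S a) c.states
  trans := insert (S, a, M.stepSet S a) c.trans

/-- One iteration of the outer loop: pop a power state and go through all letters.
Nothing happens once the stack is empty. -/
noncomputable def onTheFlyStep {α σ : Type*} [Fintype α] (M : NFA α σ)
    (c : OnTheFlyConfig α σ) : OnTheFlyConfig α σ :=
  match c.stack with
  | [] => c
  | S :: rest =>
    (Finset.univ : Finset α).toList.foldl (M.onTheFlyLetter S) { c with stack := rest }

open Classical in
/-- The on-the-fly determinization of `M` terminates (its stack gets empty after finitely many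
iterations) and returns `D`. -/
def OnTheFlyReturns {α σ : Type*} [Fintype α] (M : NFA α σ) (D : PowerAutomaton α σ) : Prop :=
  ∃ t : ℕ, (M.onTheFlyStep^[t] M.onTheFlyInit).stack = [] ∧
    D = { states := (M.onTheFlyStep^[t] M.onTheFlyInit).states
          start := M.start
          accept := (M.onTheFlyStep^[t] M.onTheFlyInit).states.filter
            fun S => (S ∩ M.accept).Nonempty
          trans := (M.onTheFlyStep^[t] M.onTheFlyInit).trans }

end NFA

/-- `P` is the law of a random automaton with `n` states, each of whose transition matrices is
uniformly distributed on the `n × n` Boolean matrices with exactly `m` nonzero entries.  Nothing is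
said about the joint law of the matrices of different letters and of the starting and accepting
states. -/
def HasUniformTransitions {α : Type*} {n : ℕ} (m : ℕ) (P : PMF (NFA α (Fin n))) : Prop :=
  ∃ h : (BoolMatrix.withNnz n m).Nonempty,
    ∀ a : α, P.map (fun M => M.transitionMatrix a) =
      PMF.uniformOfFinset (BoolMatrix.withNnz n m) h

/-! ### Products of dense matrices. -/

namespace BoolMatrix

/-! Each matrix has about a fraction `1/d` of ones, so the monoid collapses: with high probability
any product of three letters is the all-ones matrix. Put `s = ⌊√n⌋ + 1`. A row of the first factor
has at least `s` ones; since the second factor has no `s × s` zero block, that row of the product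
has at least `n - s` ones; these meet the support of every column of the third factor
(`mul_mul_eq_ones`). Multiplying further changes nothing, so with `k` letters the monoid has at most
`k² + k + 2` elements, a constant (`card_transitionMonoid_le`). Both bounds of the theorem are far
weaker.

Density holds with probability exponentially close to 1, by a union bound over zero rectangles
(`card_filter_not_isDense_le`, `eventually_choose_sqrt_bounds`). A union bound over letters uses
only the marginal laws, so dependence is harmless. Finally, determinization finds only images of the
starting set under monoid elements. -/

open Classical in
theorem mul_apply_eq_true {Q : Type*} {B C : BoolMatrix Q} {i j : Q} :
    (B * C) i j = true ↔ ∃ k, B i k = true ∧ C k j = true :=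
  decide_eq_true_iff

open Classical in
theorem one_apply_eq_true {Q : Type*} {i j : Q} : (1 : BoolMatrix Q) i j = true ↔ i = j :=
  decide_eq_true_iff

/-- The all-ones matrix. -/
def ones (Q : Type*) : BoolMatrix Q := fun _ _ => true

/-- `B` has an all-zero submatrix with `r` rows and `t` columns. -/
def HasZeroRect {n : ℕ} (B : BoolMatrix (Fin n)) (r t : ℕ) : Prop :=
  ∃ R T : Finset (Fin n), R.card = r ∧ T.card = t ∧ ∀ i ∈ R, ∀ j ∈ T, B i j = false

theorem HasZeroRect.of_le {n : ℕ} {B : BoolMatrix (Fin n)} {r t : ℕ} {R T : Finset (Fin n)}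
    (hR : r ≤ R.card) (hT : t ≤ T.card) (h : ∀ i ∈ R, ∀ j ∈ T, B i j = false) :
    B.HasZeroRect r t := by
  obtain ⟨R', hR', rfl⟩ := Finset.exists_subset_card_eq hR
  obtain ⟨T', hT', rfl⟩ := Finset.exists_subset_card_eq hT
  exact ⟨R', T', rfl, rfl, fun i hi j hj => h i (hR' hi) j (hT' hj)⟩

/-- `B` has no row or column with at least `n - s` zeros and no `s × s` all-zero submatrix. -/
structure IsDense {n : ℕ} (B : BoolMatrix (Fin n)) (s : ℕ) : Prop where
  square : ¬ B.HasZeroRect s s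
  row : ¬ B.HasZeroRect 1 (n - s)
  col : ¬ B.HasZeroRect (n - s) 1

theorem mul_mul_eq_ones {n s : ℕ} {A B C : BoolMatrix (Fin n)} (hA : A.IsDense s)
    (hB : B.IsDense s) (hC : C.IsDense s) : A * B * C = ones (Fin n) := by
  classical
  funext i j
  change (A * B * C) i j = true
  set S := Finset.univ.filter fun k => A i k = true with hS
  have hcard : s ≤ S.card := by
    by_contra! hlt
    refine hA.row (HasZeroRect.of_le (R := {i}) (T := Sᶜ) (by simp) ?_ ?_)
    · rw [Finset.card_compl, Fintype.card_fin]
      omega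
    · simp [hS]
  set U := Finset.univ.filter fun k => (A * B) i k = true with hU
  have hcardU : n - s ≤ U.card := by
    by_contra! hlt
    refine hB.square (HasZeroRect.of_le (R := S) (T := Uᶜ) hcard ?_ ?_)
    · rw [Finset.card_compl, Fintype.card_fin]
      omega
    · intro k hk l hl
      by_contra hne
      refine (Finset.mem_compl.mp hl) (Finset.mem_filter.mpr ⟨Finset.mem_univ _, ?_⟩)
      exact mul_apply_eq_true.mpr ⟨k, (Finset.mem_filter.mp hk).2, by simpa using hne⟩
  by_contra hne
  refine hC.col (HasZeroRect.of_le (R := U) (T := {j}) hcardU (by simp) ?_)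
  intro k hk l hl
  rw [Finset.mem_singleton.mp hl]
  by_contra h
  exact hne (mul_apply_eq_true.mpr ⟨k, (Finset.mem_filter.mp hk).2, by simpa using h⟩)

/-- Only the column condition matters: it forbids a zero column. -/
theorem ones_mul_eq_ones {n s : ℕ} {C : BoolMatrix (Fin n)} (hC : C.IsDense s) :
    ones (Fin n) * C = ones (Fin n) := by
  funext i j
  change (ones (Fin n) * C) i j = true
  by_contra hne
  refine hC.col (HasZeroRect.of_le (R := Finset.univ) (T := {j}) (by simp) (by simp) ?_)
  intro k _ l hl
  rw [Finset.mem_singleton.mp hl]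
  by_contra h
  exact hne (mul_apply_eq_true.mpr ⟨k, rfl, by simpa using h⟩)

/-! ### Counting matrices with a given number of nonzero entries -/

/-- The positions of the nonzero entries. -/
def support {Q : Type*} [Fintype Q] (B : BoolMatrix Q) : Finset (Q × Q) :=
  Finset.univ.filter fun p => B p.1 p.2 = true

theorem mem_support {Q : Type*} [Fintype Q] {B : BoolMatrix Q} {p : Q × Q} :
    p ∈ B.support ↔ B p.1 p.2 = true := by
  simp [support]

theorem support_injective {Q : Type*} [Fintype Q] :
    Function.Injective (support : BoolMatrix Q → Finset (Q × Q)) := by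
  intro B C h
  funext i j
  have := congrArg ((i, j) ∈ ·) h
  simp only [mem_support, eq_iff_iff] at this
  exact Bool.eq_iff_iff.mpr this

theorem mem_withNnz {n m : ℕ} {B : BoolMatrix (Fin n)} :
    B ∈ withNnz n m ↔ B.support.card = m :=
  Finset.mem_filter.trans (and_iff_right (Finset.mem_univ _))

open Classical in
theorem card_withNnz (n m : ℕ) : (withNnz n m).card = (n ^ 2).choose m := by
  have h : (withNnz n m).image support = Finset.powersetCard m Finset.univ := by
    ext s
    simp only [Finset.mem_image, mem_withNnz, Finset.mem_powersetCard, Finset.subset_univ,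
      true_and]
    constructor
    · rintro ⟨B, hB, rfl⟩
      exact hB
    · intro hs
      have : support (fun i j => decide ((i, j) ∈ s) : BoolMatrix (Fin n)) = s := by
        ext p
        exact mem_support.trans decide_eq_true_iff
      exact ⟨_, this.symm ▸ hs, this⟩
  rw [← Finset.card_image_of_injective _ support_injective, h, Finset.card_powersetCard]
  simp [sq]

open Classical in
theorem card_filter_zero_on_le (n m : ℕ) (R : Finset (Fin n × Fin n)) :
    ((withNnz n m).filter fun B => ∀ p ∈ R, B p.1 p.2 = false).card ≤
      (n ^ 2 - R.card).choose m := by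
  rw [← Finset.card_image_of_injective _ support_injective]
  have hc : (Rᶜ).card = n ^ 2 - R.card := by
    rw [Finset.card_compl]
    simp [sq]
  rw [← hc, ← Finset.card_powersetCard]
  refine Finset.card_le_card ?_
  intro s hs
  obtain ⟨B, hB, rfl⟩ := Finset.mem_image.mp hs
  obtain ⟨hm, hz⟩ := Finset.mem_filter.mp hB
  refine Finset.mem_powersetCard.mpr ⟨fun p hp => Finset.mem_compl.mpr fun hpR => ?_,
    mem_withNnz.mp hm⟩
  have := hz p hpR
  rw [mem_support.mp hp] at this
  exact Bool.noConfusion this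

end BoolMatrix

/-! ### Ratios of binomial coefficients. -/

/-- Factor by factor, `(M - i) / (N - i) ≤ M / N`. Cross-multiplied, this survives truncated
subtraction, so `m` is unrestricted. -/
theorem Nat.descFactorial_mul_pow_le {M N : ℕ} (h : M ≤ N) (m : ℕ) :
    M.descFactorial m * N ^ m ≤ N.descFactorial m * M ^ m := by
  induction m with
  | zero => simp
  | succ m ih =>
    have key : (M - m) * N ≤ (N - m) * M := by
      rw [Nat.sub_mul, Nat.sub_mul, Nat.mul_comm M N]
      exact Nat.sub_le_sub_left (Nat.mul_le_mul_left m h) _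
    calc M.descFactorial (m + 1) * N ^ (m + 1)
        = ((M - m) * N) * (M.descFactorial m * N ^ m) := by
          rw [Nat.descFactorial_succ]; ring
      _ ≤ ((N - m) * M) * (N.descFactorial m * M ^ m) := Nat.mul_le_mul key ih
      _ = N.descFactorial (m + 1) * M ^ (m + 1) := by
          rw [Nat.descFactorial_succ]; ring

theorem Nat.choose_mul_pow_le {M N : ℕ} (h : M ≤ N) (m : ℕ) :
    M.choose m * N ^ m ≤ N.choose m * M ^ m := by
  have := Nat.descFactorial_mul_pow_le h m
  rw [Nat.descFactorial_eq_factorial_mul_choose, Nat.descFactorial_eq_factorial_mul_choose,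
    mul_assoc, mul_assoc] at this
  exact Nat.le_of_mul_le_mul_left this m.factorial_pos

/-- The chance that a random `m`-subset misses `r` given points is at most `(1 - r/N)^m`, and `1 - u
≤ exp (-u)`. -/
theorem Nat.choose_sub_le_choose_mul_exp {N r : ℕ} (hN : 0 < N) (hr : r ≤ N) (m : ℕ) :
    ((N - r).choose m : ℝ) ≤ N.choose m * Real.exp (-(r * (m / N))) := by
  have hN' : (0 : ℝ) < N := by exact_mod_cast hN
  have h1 : ((N - r).choose m : ℝ) * (N : ℝ) ^ m ≤ N.choose m * ((N : ℝ) - r) ^ m := by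
    have := Nat.choose_mul_pow_le (Nat.sub_le N r) m
    rw [← Nat.cast_sub hr]
    exact_mod_cast this
  have h2 : ((N : ℝ) - r) ^ m ≤ Real.exp (-(r * (m / N))) * (N : ℝ) ^ m := by
    have h3 : (N : ℝ) - r ≤ Real.exp (-(r / N)) * N := by
      have := Real.add_one_le_exp (-(r / N : ℝ))
      calc (N : ℝ) - r = (-(r / N) + 1) * N := by field_simp; ring
        _ ≤ _ := by gcongr
    have h4 : (0 : ℝ) ≤ (N : ℝ) - r := sub_nonneg.mpr (by exact_mod_cast hr)
    calc ((N : ℝ) - r) ^ m ≤ (Real.exp (-(r / N)) * N) ^ m := by gcongr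
      _ = _ := by
        rw [mul_pow, ← Real.exp_nat_mul]
        congr 2
        ring
  have h5 : ((N - r).choose m : ℝ) * (N : ℝ) ^ m ≤
      (N.choose m * Real.exp (-(r * (m / N)))) * (N : ℝ) ^ m := by
    calc _ ≤ _ := h1
      _ ≤ N.choose m * (Real.exp (-(r * (m / N))) * (N : ℝ) ^ m) := by gcongr
      _ = _ := by ring
  exact le_of_mul_le_mul_right h5 (by positivity)

/-! ### Union bound over zero rectangles. -/

namespace BoolMatrix

open Classical in
theorem card_filter_hasZeroRect_le {n : ℕ} (hn : 0 < n) {m : ℕ} {c : ℝ}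
    (hc : c ≤ m / (n : ℝ) ^ 2) (r t : ℕ) :
    (((withNnz n m).filter fun B => B.HasZeroRect r t).card : ℝ) ≤
      n.choose r * n.choose t * Real.exp (-(c * (r * t))) * (withNnz n m).card := by
  set I : Finset (Finset (Fin n) × Finset (Fin n)) :=
    Finset.powersetCard r Finset.univ ×ˢ Finset.powersetCard t Finset.univ with hI
  have hIcard : I.card = n.choose r * n.choose t := by simp [hI, Finset.card_product]
  have hsub : ((withNnz n m).filter fun B => B.HasZeroRect r t) ⊆
      I.biUnion fun q => (withNnz n m).filter fun B => ∀ p ∈ q.1 ×ˢ q.2, B p.1 p.2 = false := by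
    intro B hB
    obtain ⟨hm, R, T, hR, hT, hz⟩ := Finset.mem_filter.mp hB
    refine Finset.mem_biUnion.mpr ⟨(R, T), by simp [hI, hR, hT], Finset.mem_filter.mpr ⟨hm, ?_⟩⟩
    intro p hp
    obtain ⟨h1, h2⟩ := Finset.mem_product.mp hp
    exact hz _ h1 _ h2
  have hterm : ∀ q ∈ I,
      (((withNnz n m).filter fun B => ∀ p ∈ q.1 ×ˢ q.2, B p.1 p.2 = false).card : ℝ) ≤
        Real.exp (-(c * (r * t))) * (withNnz n m).card := by
    intro q hq
    obtain ⟨h1, h2⟩ := Finset.mem_product.mp hq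
    have hcard : (q.1 ×ˢ q.2).card = r * t := by
      rw [Finset.card_product, (Finset.mem_powersetCard.mp h1).2,
        (Finset.mem_powersetCard.mp h2).2]
    have hle : r * t ≤ n ^ 2 := by
      rw [← hcard]
      refine (Finset.card_le_univ _).trans (by simp [sq])
    calc _ ≤ (((n ^ 2 - r * t).choose m : ℕ) : ℝ) := by
          have := card_filter_zero_on_le n m (q.1 ×ˢ q.2)
          rw [hcard] at this
          exact_mod_cast this
      _ ≤ _ := Nat.choose_sub_le_choose_mul_exp (by positivity) hle m
      _ ≤ _ := by
        have : c * (r * t) ≤ ((r * t : ℕ) : ℝ) * (m / ((n ^ 2 : ℕ) : ℝ)) := by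
          push_cast
          rw [mul_comm]
          gcongr
        rw [card_withNnz, mul_comm (Real.exp (-(c * (r * t))))]
        gcongr
  calc _ ≤ ((∑ q ∈ I, ((withNnz n m).filter
          fun B => ∀ p ∈ q.1 ×ˢ q.2, B p.1 p.2 = false).card : ℕ) : ℝ) := by
        exact_mod_cast (Finset.card_le_card hsub).trans Finset.card_biUnion_le
    _ ≤ ∑ q ∈ I, Real.exp (-(c * (r * t))) * (withNnz n m).card := by
        push_cast
        exact Finset.sum_le_sum hterm
    _ = _ := by
        rw [Finset.sum_const, hIcard, nsmul_eq_mul]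
        push_cast
        ring

open Classical in
theorem card_filter_not_isDense_le {n : ℕ} (hn : 0 < n) {m s : ℕ} (hs : s ≤ n) {c x : ℝ}
    (hc : c ≤ m / (n : ℝ) ^ 2)
    (h₁ : (n.choose s : ℝ) * n.choose s * Real.exp (-(c * (s * s))) ≤ x)
    (h₂ : (n : ℝ) * n.choose s * Real.exp (-(c * ((n : ℝ) - s))) ≤ x) :
    (((withNnz n m).filter fun B => ¬ B.IsDense s).card : ℝ) ≤ 3 * x * (withNnz n m).card := by
  have hsub : ((withNnz n m).filter fun B => ¬ B.IsDense s) ⊆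
      ((withNnz n m).filter fun B => B.HasZeroRect s s) ∪
      (((withNnz n m).filter fun B => B.HasZeroRect 1 (n - s)) ∪
      ((withNnz n m).filter fun B => B.HasZeroRect (n - s) 1)) := by
    intro B hB
    obtain ⟨hm, hd⟩ := Finset.mem_filter.mp hB
    simp only [Finset.mem_union, Finset.mem_filter, hm, true_and]
    by_contra! h
    exact hd ⟨h.1, h.2.1, h.2.2⟩
  have hle := (Finset.card_le_card hsub).trans ((Finset.card_union_le _ _).trans
    (Nat.add_le_add_left (Finset.card_union_le _ _) _))
  have hle' : (((withNnz n m).filter fun B => ¬ B.IsDense s).card : ℝ) ≤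
      ((withNnz n m).filter fun B => B.HasZeroRect s s).card +
      (((withNnz n m).filter fun B => B.HasZeroRect 1 (n - s)).card +
      ((withNnz n m).filter fun B => B.HasZeroRect (n - s) 1).card) := by
    exact_mod_cast hle
  have b₁ := card_filter_hasZeroRect_le hn hc s s
  have b₂ := card_filter_hasZeroRect_le hn hc 1 (n - s)
  have b₃ := card_filter_hasZeroRect_le hn hc (n - s) 1
  -- Long zero rows and columns are counted by the same number, which `h₂` bounds.
  rw [Nat.choose_symm hs, Nat.cast_sub hs, Nat.choose_one_right] at b₂ b₃
  have hw : (0 : ℝ) ≤ (withNnz n m).card := Nat.cast_nonneg _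
  have c₁ := b₁.trans (mul_le_mul_of_nonneg_right h₁ hw)
  have c₂ : _ ≤ x * ((withNnz n m).card : ℝ) := b₂.trans
    (mul_le_mul_of_nonneg_right (by simpa using h₂) hw)
  have c₃ : _ ≤ x * ((withNnz n m).card : ℝ) := b₃.trans
    (mul_le_mul_of_nonneg_right (by simpa [mul_comm, mul_left_comm] using h₂) hw)
  linarith

end BoolMatrix

namespace NFA

/-! ### The transition monoid -/

theorem card_transitionMonoid_le {α : Type*} [Fintype α] {n s : ℕ} (M : NFA α (Fin n))
    (h : ∀ a, (M.transitionMatrix a).IsDense s) :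
    Nat.card M.transitionMonoid ≤ Fintype.card α ^ 2 + Fintype.card α + 2 := by
  -- The values of words of length 0, at least 3, 1 and 2, in this order.
  let f : (Unit ⊕ Unit) ⊕ (α ⊕ α × α) → BoolMatrix (Fin n) :=
    Sum.elim (Sum.elim (fun _ => 1) fun _ => BoolMatrix.ones (Fin n))
      (Sum.elim M.transitionMatrix fun p => M.transitionMatrix p.1 * M.transitionMatrix p.2)
  have hsub : (M.transitionMonoid : Set (BoolMatrix (Fin n))) ⊆ Set.range f := by
    intro B hB
    induction hB using Submonoid.closure_induction_right with
    | one => exact ⟨Sum.inl (Sum.inl ()), rfl⟩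
    | mul_right B _ C hC ih =>
      obtain ⟨c, rfl⟩ := hC
      obtain ⟨(⟨⟨⟩⟩ | ⟨⟨⟩⟩) | (a | ⟨a, b⟩), rfl⟩ := ih
      · exact ⟨Sum.inr (Sum.inl c), (one_mul _).symm⟩
      · exact ⟨Sum.inl (Sum.inr ()), (BoolMatrix.ones_mul_eq_ones (h c)).symm⟩
      · exact ⟨Sum.inr (Sum.inr (a, c)), rfl⟩
      · exact ⟨Sum.inl (Sum.inr ()), (BoolMatrix.mul_mul_eq_ones (h a) (h b) (h c)).symm⟩
  calc Nat.card M.transitionMonoid ≤ Nat.card (Set.range f) :=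
        Nat.card_mono (Set.finite_range f) hsub
    _ ≤ Nat.card ((Unit ⊕ Unit) ⊕ (α ⊕ α × α)) :=
        Nat.card_le_card_of_surjective _ Set.rangeFactorization_surjective
    _ = _ := by
        simp
        ring

/-! ### The on-the-fly determinization -/

/-- The power states that the elements of the transition monoid reach from the starting set. -/
def reachableSets {α σ : Type*} (M : NFA α σ) : Set (Set σ) :=
  (fun B : BoolMatrix σ => {q | ∃ p ∈ M.start, B p q = true}) '' (M.transitionMonoid : Set _)

theorem start_mem_reachableSets {α σ : Type*} (M : NFA α σ) : M.start ∈ M.reachableSets := by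
  refine ⟨1, one_mem _, ?_⟩
  ext q
  simp [BoolMatrix.one_apply_eq_true]

theorem stepSet_mem_reachableSets {α σ : Type*} (M : NFA α σ) {S : Set σ}
    (hS : S ∈ M.reachableSets) (a : α) : M.stepSet S a ∈ M.reachableSets := by
  obtain ⟨B, hB, rfl⟩ := hS
  refine ⟨B * M.transitionMatrix a,
    mul_mem hB (Submonoid.subset_closure (Set.mem_range_self a)), ?_⟩
  ext q
  simp only [BoolMatrix.mul_apply_eq_true, Set.mem_ofPred_eq, mem_stepSet, transitionMatrix,
    decide_eq_true_iff]
  constructor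
  · rintro ⟨p, hp, k, h1, h2⟩
    exact ⟨k, ⟨p, hp, h1⟩, h2⟩
  · rintro ⟨k, ⟨p, hp, h1⟩, h2⟩
    exact ⟨p, hp, k, h1, h2⟩

theorem ncard_reachableSets_le {α σ : Type*} [Finite σ] (M : NFA α σ) :
    M.reachableSets.ncard ≤ Nat.card M.transitionMonoid :=
  Set.ncard_image_le (Set.toFinite _)

/-- All power states of `c`, found or stacked, are reachable. -/
def OnTheFlyConfig.Sound {α σ : Type*} (M : NFA α σ) (c : OnTheFlyConfig α σ) : Prop :=
  (∀ S ∈ c.stack, S ∈ M.reachableSets) ∧ ∀ S ∈ c.states, S ∈ M.reachableSets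

theorem onTheFlyLetter_sound {α σ : Type*} (M : NFA α σ) {S : Set σ} (hS : S ∈ M.reachableSets)
    {c : OnTheFlyConfig α σ} (hc : c.Sound M) (a : α) : (M.onTheFlyLetter S c a).Sound M := by
  have hstep := M.stepSet_mem_reachableSets hS a
  refine ⟨fun T hT => ?_, fun T hT => ?_⟩
  · simp only [onTheFlyLetter] at hT
    split_ifs at hT
    · exact hc.1 T hT
    · rcases List.mem_cons.mp hT with rfl | hT
      exacts [hstep, hc.1 T hT]
  · rcases Finset.mem_insert.mp hT with rfl | hT
    exacts [hstep, hc.2 T hT]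

/-- Each newly found power state is pushed exactly once, so stack and state set grow equally; this
drives the termination count. -/
theorem onTheFlyLetter_length {α σ : Type*} (M : NFA α σ) (S : Set σ) (c : OnTheFlyConfig α σ)
    (a : α) : (M.onTheFlyLetter S c a).stack.length + c.states.card =
      c.stack.length + (M.onTheFlyLetter S c a).states.card := by
  classical
  simp only [onTheFlyLetter]
  split_ifs with h
  · rw [Finset.insert_eq_of_mem h]
  · rw [Finset.card_insert_of_notMem h, List.length_cons]
    omega

theorem foldl_onTheFlyLetter_sound {α σ : Type*} (M : NFA α σ) {S : Set σ}
    (hS : S ∈ M.reachableSets) (l : List α) {c : OnTheFlyConfig α σ} (hc : c.Sound M) :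
    (l.foldl (M.onTheFlyLetter S) c).Sound M := by
  induction l generalizing c with
  | nil => exact hc
  | cons a l ih => exact ih (M.onTheFlyLetter_sound hS hc a)

theorem foldl_onTheFlyLetter_length {α σ : Type*} (M : NFA α σ) (S : Set σ) (l : List α)
    (c : OnTheFlyConfig α σ) :
    (l.foldl (M.onTheFlyLetter S) c).stack.length + c.states.card =
      c.stack.length + (l.foldl (M.onTheFlyLetter S) c).states.card := by
  induction l generalizing c with
  | nil => rfl
  | cons a l ih =>
    have h1 := ih (M.onTheFlyLetter S c a)
    have h2 := M.onTheFlyLetter_length S c a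
    rw [List.foldl_cons]
    omega

theorem onTheFlyStep_sound {α σ : Type*} [Fintype α] (M : NFA α σ) {c : OnTheFlyConfig α σ}
    (hc : c.Sound M) : (M.onTheFlyStep c).Sound M := by
  obtain ⟨stack, states, trans⟩ := c
  cases stack with
  | nil => exact hc
  | cons S rest =>
    refine M.foldl_onTheFlyLetter_sound (hc.1 S List.mem_cons_self) _ ⟨fun T hT => ?_, hc.2⟩
    exact hc.1 T (List.mem_cons_of_mem _ hT)

theorem onTheFlyStep_length {α σ : Type*} [Fintype α] (M : NFA α σ) {c : OnTheFlyConfig α σ}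
    (hc : c.stack ≠ []) : (M.onTheFlyStep c).stack.length + 1 + c.states.card =
      c.stack.length + (M.onTheFlyStep c).states.card := by
  obtain ⟨stack, states, trans⟩ := c
  cases stack with
  | nil => exact absurd rfl hc
  | cons S rest =>
    have := M.foldl_onTheFlyLetter_length S (Finset.univ : Finset α).toList ⟨rest, states, trans⟩
    simp only [onTheFlyStep, List.length_cons] at this ⊢
    omega

theorem iterate_onTheFlyStep_sound {α σ : Type*} [Fintype α] (M : NFA α σ) (t : ℕ) :
    (M.onTheFlyStep^[t] M.onTheFlyInit).Sound M := by
  induction t with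
  | zero =>
    have := M.start_mem_reachableSets
    constructor <;> simpa [onTheFlyInit]
  | succ t ih =>
    rw [Function.iterate_succ_apply']
    exact M.onTheFlyStep_sound ih

theorem exists_iterate_onTheFlyStep_stack_eq_nil {α σ : Type*} [Fintype α] [Finite σ]
    (M : NFA α σ) : ∃ t, (M.onTheFlyStep^[t] M.onTheFlyInit).stack = [] := by
  by_contra! h
  -- Every state found is either still stacked or was popped in one of the `t` iterations. As there
  -- are finitely many power states, this bounds `t`.
  have key : ∀ t, (M.onTheFlyStep^[t] M.onTheFlyInit).stack.length + t =
      (M.onTheFlyStep^[t] M.onTheFlyInit).states.card := by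
    intro t
    induction t with
    | zero => simp [onTheFlyInit]
    | succ t ih =>
      rw [Function.iterate_succ_apply']
      have := M.onTheFlyStep_length (h t)
      omega
  have := Fintype.ofFinite (Set σ)
  have h1 := key (Fintype.card (Set σ))
  have h2 := List.length_pos_of_ne_nil (h (Fintype.card (Set σ)))
  have h3 := Finset.card_le_univ
    (M.onTheFlyStep^[Fintype.card (Set σ)] M.onTheFlyInit).states
  omega

theorem exists_onTheFlyReturns {α σ : Type*} [Fintype α] [Finite σ] (M : NFA α σ) :
    ∃ D : PowerAutomaton α σ, M.OnTheFlyReturns D ∧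
      D.states.card ≤ Nat.card M.transitionMonoid := by
  obtain ⟨t, ht⟩ := M.exists_iterate_onTheFlyStep_stack_eq_nil
  refine ⟨_, ⟨t, ht, rfl⟩, le_trans ?_ M.ncard_reachableSets_le⟩
  rw [← Set.ncard_coe_finset]
  exact Set.ncard_le_ncard (M.iterate_onTheFlyStep_sound t).2 (Set.toFinite _)

end NFA

/-! ### Probability -/

open Classical in
theorem HasUniformTransitions.toOuterMeasure_isDense_ge {α : Type*} [Fintype α] {n m s : ℕ}
    {P : PMF (NFA α (Fin n))} (hP : HasUniformTransitions m P) {y : ℝ}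
    (hy : (((BoolMatrix.withNnz n m).filter fun B => ¬ B.IsDense s).card : ℝ) ≤
      y * (BoolMatrix.withNnz n m).card) :
    ENNReal.ofReal (1 - Fintype.card α * y) ≤
      P.toOuterMeasure {M | ∀ a, (M.transitionMatrix a).IsDense s} := by
  obtain ⟨hne, hP⟩ := hP
  have hpos : (0 : ℝ) < (BoolMatrix.withNnz n m).card := by exact_mod_cast hne.card_pos
  have hy0 : 0 ≤ y := by
    have := (Nat.cast_nonneg _).trans hy
    exact nonneg_of_mul_nonneg_left this hpos
  have hletter : ∀ a, P.toOuterMeasure {M | ¬ (M.transitionMatrix a).IsDense s} ≤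
      ENNReal.ofReal y := by
    intro a
    have h1 := PMF.toOuterMeasure_map_apply (fun M : NFA α (Fin n) => M.transitionMatrix a) P
      {B | ¬ B.IsDense s}
    rw [hP a, PMF.toOuterMeasure_uniformOfFinset_apply] at h1
    change P.toOuterMeasure ((fun M : NFA α (Fin n) => M.transitionMatrix a) ⁻¹'
      {B | ¬ B.IsDense s}) ≤ _
    rw [← h1]
    refine ENNReal.div_le_of_le_mul ?_
    rw [← ENNReal.ofReal_natCast, ← ENNReal.ofReal_natCast, ← ENNReal.ofReal_mul hy0]
    exact ENNReal.ofReal_le_ofReal (by simpa using hy)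
  set G : Set (NFA α (Fin n)) := {M | ∀ a, (M.transitionMatrix a).IsDense s} with hG
  have hcover : (Set.univ : Set (NFA α (Fin n))) ⊆
      G ∪ ⋃ a, {M | ¬ (M.transitionMatrix a).IsDense s} := by
    intro M _
    by_cases h : M ∈ G
    · exact Or.inl h
    · simp only [hG, Set.mem_ofPred_eq, not_forall] at h
      exact Or.inr (Set.mem_iUnion.mpr h)
  have huniv : P.toOuterMeasure Set.univ = 1 :=
    (PMF.toOuterMeasure_apply_eq_one_iff _ _).mpr (Set.subset_univ _)
  have hsum : (1 : ENNReal) ≤ P.toOuterMeasure G + ENNReal.ofReal (Fintype.card α * y) := by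
    calc (1 : ENNReal) = P.toOuterMeasure Set.univ := huniv.symm
      _ ≤ P.toOuterMeasure G +
          P.toOuterMeasure (⋃ a, {M | ¬ (M.transitionMatrix a).IsDense s}) :=
        (MeasureTheory.measure_mono hcover).trans (MeasureTheory.measure_union_le _ _)
      _ ≤ P.toOuterMeasure G + ∑ a : α, ENNReal.ofReal y := by
        gcongr
        exact (MeasureTheory.measure_iUnion_fintype_le _ _).trans
          (Finset.sum_le_sum fun a _ => hletter a)
      _ = _ := by
        rw [Finset.sum_const, nsmul_eq_mul, Finset.card_univ,
          ENNReal.ofReal_mul (Nat.cast_nonneg _), ENNReal.ofReal_natCast]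
  rw [ENNReal.ofReal_sub _ (by positivity), ENNReal.ofReal_one]
  exact tsub_le_iff_right.mpr hsum

/-! ### Asymptotics -/

/-- With `s` about `√n`, the entropy `s log n` of the choices is `o(n)`, while both exponents `c s²`
and `c (n - s)` are of order `c n`. The factor `c / 4` leaves slack. -/
theorem eventually_choose_sqrt_bounds {c : ℝ} (hc : 0 < c) :
    ∀ᶠ n : ℕ in Filter.atTop, Nat.sqrt n + 1 ≤ n ∧
      (n.choose (Nat.sqrt n + 1) : ℝ) * n.choose (Nat.sqrt n + 1) *
        Real.exp (-(c * (((Nat.sqrt n + 1 : ℕ) : ℝ) * (Nat.sqrt n + 1 : ℕ)))) ≤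
          Real.exp (-(c / 4 * n)) ∧
      (n : ℝ) * n.choose (Nat.sqrt n + 1) *
        Real.exp (-(c * ((n : ℝ) - (Nat.sqrt n + 1 : ℕ)))) ≤ Real.exp (-(c / 4 * n)) := by
  have hlog := ((isLittleO_log_rpow_atTop (r := 1 / 2) (by norm_num)).comp_tendsto
    tendsto_natCast_atTop_atTop).bound (show 0 < c / 12 by positivity)
  filter_upwards [hlog, Filter.eventually_ge_atTop 16] with n hl hn
  have hn1 : (1 : ℝ) ≤ n := by exact_mod_cast (by omega : 1 ≤ n)
  have hn16 : (16 : ℝ) ≤ n := by exact_mod_cast hn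
  have hlog0 : 0 ≤ Real.log n := Real.log_nonneg hn1
  set s := Nat.sqrt n + 1 with hs
  set x := Real.sqrt n with hx
  have hxx : x * x = n := Real.mul_self_sqrt (by positivity)
  have hx4 : 4 ≤ x := Real.le_sqrt_of_sq_le (by linarith)
  have hl : Real.log n ≤ c / 12 * x := by
    simpa only [Function.comp_apply, Real.norm_eq_abs, abs_of_nonneg hlog0, ← Real.sqrt_eq_rpow,
      abs_of_nonneg (Real.sqrt_nonneg _)] using hl
  have hsx : x ≤ s := by
    rw [hx, Real.sqrt_le_left (by positivity)]
    exact_mod_cast (by rw [hs, sq]; exact (Nat.lt_succ_sqrt n).le : n ≤ s ^ 2)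
  have hsx' : (s : ℝ) ≤ x + 1 := by
    have := Real.nat_sqrt_le_real_sqrt (a := n)
    rw [hs]
    push_cast
    linarith
  have hsn : s ≤ n := by
    have : (s : ℝ) ≤ n := by nlinarith
    exact_mod_cast this
  have hchoose : (n.choose s : ℝ) ≤ Real.exp (s * Real.log n) := by
    rw [Real.exp_nat_mul, Real.exp_log (by linarith)]
    exact_mod_cast Nat.choose_le_pow n s
  have hs0 : (0 : ℝ) ≤ s := Nat.cast_nonneg _
  have hsl : s * Real.log n ≤ s * (c / 12 * x) := by gcongr
  refine ⟨hsn, ?_, ?_⟩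
  · calc _ ≤ Real.exp (s * Real.log n) * Real.exp (s * Real.log n) *
          Real.exp (-(c * ((s : ℝ) * s))) := by gcongr
      _ = Real.exp (s * Real.log n + s * Real.log n + -(c * ((s : ℝ) * s))) := by
        rw [Real.exp_add, Real.exp_add]
      _ ≤ _ := by
        refine Real.exp_le_exp.mpr ?_
        have h1 : c * (s * x) ≤ c * (s * s) := by gcongr
        have h2 : c * (x * x) ≤ c * (s * s) := by gcongr
        rw [hxx] at h2
        nlinarith
  · calc _ ≤ Real.exp (Real.log n) * Real.exp (s * Real.log n) *
          Real.exp (-(c * ((n : ℝ) - s))) := by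
          gcongr
          rw [Real.exp_log (by linarith)]
      _ = Real.exp (Real.log n + s * Real.log n + -(c * ((n : ℝ) - s))) := by
        rw [Real.exp_add, Real.exp_add]
      _ ≤ _ := by
        refine Real.exp_le_exp.mpr ?_
        have h1 : s * (c / 12 * x) ≤ (x + 1) * (c / 12 * x) := by gcongr
        have h2 : c * 4 * x ≤ c * x * x := by nlinarith
        have h3 : c * s ≤ c * (x + 1) := by gcongr
        have h4 : c * 4 ≤ c * x := by gcongr
        have h5 : c * n = c * x * x := by rw [← hxx]; ring
        nlinarith

theorem mainTheorem2 (α : Type*) [Fintype α] [Nonempty α] (d : ℝ) (hd : 1 ≤ d) :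
    ∃ (ε δ : ℕ → ℝ) (C : ℝ),
      Filter.Tendsto ε Filter.atTop (nhds 0) ∧ Filter.Tendsto δ Filter.atTop (nhds 0) ∧
      ∀ (n m : ℕ), ⌊(n : ℝ) ^ 2 / d⌋₊ ≤ m → m ≤ ⌈(n : ℝ) ^ 2 / d⌉₊ →
        ∀ P : PMF (NFA α (Fin n)), HasUniformTransitions m P →
          (2 ≤ Fintype.card α →
            ENNReal.ofReal (1 - δ n) ≤ P.toOuterMeasure
              {M | (Nat.card M.transitionMonoid : ℝ) ≤
                2 * (Fintype.card α : ℝ) ^ (d * Real.log n + ε n)}) ∧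
          ENNReal.ofReal (1 - δ n) ≤ P.toOuterMeasure
            {M | ∃ D : NFA.PowerAutomaton α (Fin n), M.OnTheFlyReturns D ∧
              (D.states.card : ℝ) ≤ C * (n : ℝ) ^ (d * Real.log (Fintype.card α))} := by
  have hd0 : 0 < d := by linarith
  -- Half the density `1/d`: the loss absorbs the rounding of `m` once `n² / d ≥ 2`.
  set c : ℝ := 1 / (2 * d) with hc
  have hc0 : 0 < c := by positivity
  set k := Fintype.card α with hk
  have hlarge : ∀ᶠ n : ℕ in Filter.atTop, 3 ≤ Real.log n ∧ 2 * d ≤ (n : ℝ) ∧ 1 ≤ n :=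
    ((Real.tendsto_log_atTop.comp tendsto_natCast_atTop_atTop).eventually_ge_atTop 3).and
      ((tendsto_natCast_atTop_atTop.eventually_ge_atTop _).and (Filter.eventually_ge_atTop 1))
  obtain ⟨N, hN⟩ := Filter.eventually_atTop.mp ((eventually_choose_sqrt_bounds hc0).and hlarge)
  -- The value 1 below `N` makes the claims trivial there; the factor 3 counts the three kinds of
  -- zero rectangle.
  refine ⟨fun _ => 0, fun n => if N ≤ n then k * (3 * Real.exp (-(c / 4 * n))) else 1,
    (k : ℝ) ^ 2 + k + 2, tendsto_const_nhds, ?_, ?_⟩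
  · have hlim : Filter.Tendsto (fun n : ℕ => (k : ℝ) * (3 * Real.exp (-(c / 4 * n))))
        Filter.atTop (nhds 0) := by
      have : Filter.Tendsto (fun n : ℕ => c / 4 * (n : ℝ)) Filter.atTop Filter.atTop :=
        tendsto_natCast_atTop_atTop.const_mul_atTop (by positivity)
      simpa using ((Real.tendsto_exp_neg_atTop_nhds_zero.comp this).const_mul 3).const_mul (k : ℝ)
    refine hlim.congr' ?_
    filter_upwards [Filter.eventually_ge_atTop N] with n hn
    rw [if_pos hn]
  · intro n m hm _ P hP
    by_cases hn : N ≤ n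
    swap
    · simp [hn]
    simp only [if_pos hn, add_zero]
    obtain ⟨⟨hs, h₁, h₂⟩, hlog, hnd, hn1⟩ := hN n hn
    have hn1' : (1 : ℝ) ≤ n := by exact_mod_cast hn1
    have hcm : c ≤ m / (n : ℝ) ^ 2 := by
      have h3 : (n : ℝ) ^ 2 / d < m + 1 :=
        (Nat.lt_floor_add_one _).trans_le (by exact_mod_cast Nat.add_le_add_right hm 1)
      have h4 : 2 ≤ (n : ℝ) ^ 2 / d := by
        rw [le_div_iff₀ hd0]
        nlinarith
      rw [le_div_iff₀ (by positivity)]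
      have h5 : c * (n : ℝ) ^ 2 = (n : ℝ) ^ 2 / d / 2 := by rw [hc]; field_simp
      linarith
    classical
    have hprob := hP.toOuterMeasure_isDense_ge
      (BoolMatrix.card_filter_not_isDense_le hn1 hs hcm h₁ h₂)
    have hcard : ∀ M : NFA α (Fin n),
        (∀ a, (M.transitionMatrix a).IsDense (Nat.sqrt n + 1)) →
        (Nat.card M.transitionMonoid : ℝ) ≤ (k : ℝ) ^ 2 + k + 2 := fun M hM => by
      exact_mod_cast M.card_transitionMonoid_le hM
    refine ⟨fun hk2 => hprob.trans (MeasureTheory.measure_mono fun M hM => ?_),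
      hprob.trans (MeasureTheory.measure_mono fun M hM => ?_)⟩
    · have hk2' : (2 : ℝ) ≤ k := by exact_mod_cast hk2
      refine (hcard M hM).trans ?_
      -- `log n ≥ 3` and `d ≥ 1` give the exponent; for `k ≥ 2`, `k² + k + 2 ≤ 2 k³`.
      have h3 : (k : ℝ) ^ 3 ≤ (k : ℝ) ^ (d * Real.log n) := by
        rw [← Real.rpow_natCast]
        exact Real.rpow_le_rpow_of_exponent_le (by linarith) (by push_cast; nlinarith)
      nlinarith [mul_nonneg (sub_nonneg.mpr hk2') (sq_nonneg (k : ℝ))]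
    · obtain ⟨D, hD, hle⟩ := M.exists_onTheFlyReturns
      refine ⟨D, hD, ?_⟩
      have hpow : 1 ≤ (n : ℝ) ^ (d * Real.log k) :=
        Real.one_le_rpow hn1' (mul_nonneg hd0.le (Real.log_natCast_nonneg k))
      calc (D.states.card : ℝ) ≤ Nat.card M.transitionMonoid := by exact_mod_cast hle
        _ ≤ (k : ℝ) ^ 2 + k + 2 := hcard M hM
        _ ≤ _ := le_mul_of_one_le_right (by positivity) hpow
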